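/- Let $R$ be a ring with unit and let $\mathcal V$ be a variety (equational class) of unital $R$-modules expanded by $R$-multilinear operations $f\in F$ of arities $n=n_f\ge 1$. Let $A\in\mathcal V$, let $\pi:A\to Q$ be a surjective homomorphism, $I=\ker\pi$ (an algebra under the restricted operations), and let $T$ be the 2-cocycle associated to $\pi$ by a lifting $l:Q\to A$ ($\pi\circ l=\mathrm{id}_Q$, $l(0)=0$), as defined below. Then \[ 1\longrightarrow \mathrm{Der}(Q,I)\stackrel{\iota}{\longrightarrow}\mathrm{Aut}_I A\stackrel{\psi}{\longrightarrow}\mathrm{Aut}\,I\times\mathrm{Aut}\,Q\stackrel{W_T}{\longrightarrow} FA\big(H^2_{\mathcal V}(Q,I)\big) \] is exact: $\iota$ and $\psi$ are well-defined group homomorphisms, $\iota$ is injective, $\operatorname{im}\iota=\ker\psi$, and $\operatorname{im}\psi=\{(\sigma,\kappa): W_T(\sigma,\kappa)=0\}$. The terms are as follows. Write $[n]^*$ for the set of nonempty proper subsets of $[n]=\{1,\dots,n\}$; for tuples $\vec b,\vec a$ and $s\subseteq[n]$, $\vec b_s[\vec a]$ is $\vec b$ with the entries at the places in $s$ replaced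 by those of $\vec a$. (1) A factor system $T=(T_+,T_r,T_f,a(f,s))$ $(r\in R,\ f\in F,\ s\in[n_f]^*)$ consists of maps $T_+:Q^2\to I$, $T_r:Q\to I$, $T_f:Q^{n}\to I$ and $a(f,s):Q^{[n]\setminus s}\times I^{s}\to I$. We write $a(f,s)(\vec x,\vec a)$ also for full tuples $\vec x\in Q^n,\vec a\in I^n$; only the $x_i$ with $i\notin s$ and the $a_i$ with $i\in s$ are used. $I\rtimes_T Q$ is the set $I\times Q$ with zero $\langle 0,0\rangle$ and operations $\langle a,x\rangle+\langle b,y\rangle=\langle a+b+T_+(x,y),x+y\rangle$, $r\langle a,x\rangle=\langle ra+T_r(x),rx\rangle$, and, for $a_1,\dots,a_n\in I$, $x_1,\dots,x_n\in Q$, \[ F_f(\langle a_1,x_1\rangle,\dots,\langle a_n,x_n\rangle)=\Big\langle f^I(\vec a)+\sum_{s\in[n]^*}a(f,s)(\vec x,\vec a)+T_f(\vec x),\ f^Q(\vec x)\Big\rangle . \] $T$ is a 2-cocycle compatible with $\mathcal V$, written $T\in Z^2_{\mathcal V}(Q,I)$, if each $a(f,s)$ vanishes whenever one of its arguments is $0$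 and $I\rtimes_TQ\in\mathcal V$. The 2-cocycle associated to $\pi$ by $l$ is $T_+(x,y)=l(x)+l(y)-l(x+y)$, $T_r(x)=r\,l(x)-l(rx)$, $T_f(\vec x)=f^A(l(\vec x))-l(f^Q(\vec x))$, $a(f,s)(\vec x,\vec a)=f^A\big(l(\vec x)_s[\vec a]\big)$; it belongs to $Z^2_{\mathcal V}(Q,I)$. (2) $H^2_{\mathcal V}(Q,I)=Z^2_{\mathcal V}(Q,I)/{\sim}$, where $T\sim T'$ iff there is $h:Q\to I$ with $h(0)=0$ such that for all $x,y\in Q$, $r\in R$, $f\in F$ (with $n=n_f$), $s\in[n]^*$, $\vec x\in Q^n$, $\vec a\in I^n$: $T_+(x,y)-T'_+(x,y)=h(x)+h(y)-h(x+y)$; $T_r(x)-T'_r(x)=r\,h(x)-h(rx)$; \[ T_f(\vec x)-T'_f(\vec x)=\sum_{s\in[n]^*}(-1)^{1+|s|}a(f,s)(\vec x,h(\vec x))+(-1)^{1+n}f^I(h(\vec x))-h(f^Q(\vec x)); \] \[ a(f,s)(\vec x,\vec a)-a'(f,s)(\vec x,\vec a)=\sum_{s\subsetneq r\subsetneq[n]}(-1)^{1+|r|-|s|}a(f,r)\big(\vec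 x,h(\vec x)_s[\vec a]\big)+(-1)^{1+n-|s|}f^I\big(h(\vec x)_s[\vec a]\big). \] $FA(X)$ is the free abelian group on the set $X$. (3) $\mathrm{Der}(Q,I)$ is the set of $R$-linear $d:Q\to I$ such that for all $f\in F$ (with $n=n_f$), $s\in[n]^*$, $\vec x\in Q^n$, $\vec a\in I^n$: $d(f^Q(\vec x))=\sum_{s\in[n]^*}a(f,s)(\vec x,d(\vec x))+f^I(d(\vec x))$ and $\sum_{s\subsetneq r\subsetneq[n]}a(f,r)(\vec x,d(\vec x)_s[\vec a])+f^I(d(\vec x)_s[\vec a])=0$, where the $a(f,s)$ are the action terms of the associated $T$. It is a group under pointwise addition, and $\iota(d)(a)=a+d(\pi(a))$. (4) $\mathrm{Aut}_IA=\{\phi\in\mathrm{Aut}\,A:\phi(I)=I\}$ and $\psi(\phi)=(\phi|_I,\ \pi\circ\phi\circ l')$, where $l'$ is any map with $\pi\circ l'=\mathrm{id}_Q$; the result does not depend on $l'$. (5) $W_T(\sigma,\kappa)=[T]-[T^{(\sigma,\kappa)}]$ is the formal difference in $FA(H^2_{\mathcal V}(Q,I))$, where $T^{(\sigma,\kappa)}\in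 Z^2_{\mathcal V}(Q,I)$ is given by $T^{(\sigma,\kappa)}_+(x,y)=\sigma T_+(\kappa^{-1}x,\kappa^{-1}y)$, $T^{(\sigma,\kappa)}_r(x)=\sigma T_r(\kappa^{-1}x)$, $T^{(\sigma,\kappa)}_f(\vec x)=\sigma T_f(\kappa^{-1}\vec x)$ and $a(f,s)^{(\sigma,\kappa)}(\vec x,\vec a)=\sigma\,a(f,s)(\kappa^{-1}\vec x,\sigma^{-1}\vec a)$. -/

import Mathlib

/-- A signature of multilinear operation symbols. Every symbol takes at least one argument. -/
structure MultSig where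
  Op : Type*
  arity : Op → ℕ
  arity_pos : ∀ f, 0 < arity f

/-- An `R`-module expanded by multilinear operations named by the symbols of `S`. -/
class MultAlg (R : Type*) [Ring R] (S : MultSig) (A : Type*) [AddCommGroup A] [Module R A] where
  op : (f : S.Op) → MultilinearMap R (fun _ : Fin (S.arity f) => A) A

/-! ### Terms, identities and varieties -/

/-- A set with operations in the signature `{0, +, r · (r ∈ R)} ∪ S`, not subject to any law. -/
structure RawAlg (R : Type*) (S : MultSig) (X : Type*) where
  zero : X
  add : X → X → X
  smul : R → X → X
  op : (f : S.Op) → (Fin (S.arity f) → X) → X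

/-- Terms in the signature `{0, +, r · (r ∈ R)} ∪ S` over countably many variables. -/
inductive MTerm (R : Type*) (S : MultSig)
  | var (n : ℕ) : MTerm R S
  | zero : MTerm R S
  | add (t s : MTerm R S) : MTerm R S
  | smul (r : R) (t : MTerm R S) : MTerm R S
  | op (f : S.Op) (t : Fin (S.arity f) → MTerm R S) : MTerm R S

/-- The value of a term under an assignment of the variables. -/
def MTerm.eval {R : Type*} {S : MultSig} {X : Type*} (B : RawAlg R S X) (v : ℕ → X) :
    MTerm R S → X
  | .var n => v n
  | .zero => B.zero
  | .add t s => B.add (t.eval B v) (s.eval B v)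
  | .smul r t => B.smul r (t.eval B v)
  | .op f t => B.op f (fun i => (t i).eval B v)

/-- The laws of unital `R`-modules and the multilinearity laws of the operations of `S`. -/
inductive BaseLaw (R : Type*) [Ring R] (S : MultSig) : MTerm R S → MTerm R S → Prop
  | add_assoc : BaseLaw R S (.add (.add (.var 0) (.var 1)) (.var 2))
      (.add (.var 0) (.add (.var 1) (.var 2)))
  | add_comm : BaseLaw R S (.add (.var 0) (.var 1)) (.add (.var 1) (.var 0))
  | zero_add : BaseLaw R S (.add .zero (.var 0)) (.var 0)
  | one_smul : BaseLaw R S (.smul 1 (.var 0)) (.var 0)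
  | zero_smul : BaseLaw R S (.smul 0 (.var 0)) .zero
  | mul_smul (r s : R) : BaseLaw R S (.smul (r * s) (.var 0)) (.smul r (.smul s (.var 0)))
  | add_smul (r s : R) : BaseLaw R S (.smul (r + s) (.var 0))
      (.add (.smul r (.var 0)) (.smul s (.var 0)))
  | smul_add (r : R) : BaseLaw R S (.smul r (.add (.var 0) (.var 1)))
      (.add (.smul r (.var 0)) (.smul r (.var 1)))
  | op_add (f : S.Op) (i : Fin (S.arity f)) : BaseLaw R S
      (.op f (Function.update (fun j : Fin (S.arity f) => MTerm.var (j : ℕ)) i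
        (.add (.var i) (.var (S.arity f)))))
      (.add (.op f (fun j : Fin (S.arity f) => MTerm.var (j : ℕ)))
        (.op f (Function.update (fun j : Fin (S.arity f) => MTerm.var (j : ℕ)) i
          (.var (S.arity f)))))
  | op_smul (f : S.Op) (i : Fin (S.arity f)) (r : R) : BaseLaw R S
      (.op f (Function.update (fun j : Fin (S.arity f) => MTerm.var (j : ℕ)) i
        (.smul r (.var i))))
      (.smul r (.op f (fun j : Fin (S.arity f) => MTerm.var (j : ℕ))))

/-- A variety of `R`-modules expanded by multilinear operations, given by a set of identities
that contains the module and multilinearity laws. -/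
structure MultVariety (R : Type*) [Ring R] (S : MultSig) where
  identities : Set (MTerm R S × MTerm R S)
  base : ∀ t s, BaseLaw R S t s → (t, s) ∈ identities

/-- Membership of an algebra in a variety: all identities hold under all assignments. -/
def MultVariety.Mem {R : Type*} [Ring R] {S : MultSig} (V : MultVariety R S) {X : Type*}
    (B : RawAlg R S X) : Prop :=
  ∀ p ∈ V.identities, ∀ v : ℕ → X, p.1.eval B v = p.2.eval B v

/-- The underlying algebra, in the full signature, of a module with multilinear operations. -/
def MultAlg.toRaw (R : Type*) [Ring R] (S : MultSig) (A : Type*) [AddCommGroup A] [Module R A]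
    [MultAlg R S A] : RawAlg R S A where
  zero := 0
  add a b := a + b
  smul r a := r • a
  op f a := MultAlg.op (R := R) f a

theorem MTerm.eval_hom {R : Type*} {S : MultSig} {X Y : Type*} (B : RawAlg R S X)
    (C : RawAlg R S Y) (e : X → Y) (h0 : e B.zero = C.zero)
    (ha : ∀ x y, e (B.add x y) = C.add (e x) (e y))
    (hs : ∀ r x, e (B.smul r x) = C.smul r (e x))
    (ho : ∀ f x, e (B.op f x) = C.op f (fun i => e (x i))) (v : ℕ → X) (t : MTerm R S) :
    e (t.eval B v) = t.eval C (fun n => e (v n)) := by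
  induction t with
  | var n => rfl
  | zero => exact h0
  | add t s iht ihs => simp only [MTerm.eval, ha, iht, ihs]
  | smul r t ih => simp only [MTerm.eval, hs, ih]
  | op f t ih => simp only [MTerm.eval, ho, ih]

theorem MultVariety.Mem.of_injective {R : Type*} [Ring R] {S : MultSig} {V : MultVariety R S}
    {X Y : Type*} {B : RawAlg R S X} {C : RawAlg R S Y} (hC : V.Mem C) (e : X → Y)
    (he : Function.Injective e) (h0 : e B.zero = C.zero)
    (ha : ∀ x y, e (B.add x y) = C.add (e x) (e y))
    (hs : ∀ r x, e (B.smul r x) = C.smul r (e x))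
    (ho : ∀ f x, e (B.op f x) = C.op f (fun i => e (x i))) : V.Mem B := by
  intro p hp v
  apply he
  rw [MTerm.eval_hom B C e h0 ha hs ho, MTerm.eval_hom B C e h0 ha hs ho]
  exact hC p hp _

/-! ### Homomorphisms, kernels and automorphism groups -/

/-- Homomorphisms of modules with multilinear operations. -/
structure MultHom (R : Type*) [Ring R] (S : MultSig) (A Q : Type*)
    [AddCommGroup A] [Module R A] [MultAlg R S A]
    [AddCommGroup Q] [Module R Q] [MultAlg R S Q] extends A →ₗ[R] Q where
  map_op : ∀ (f : S.Op) (a : Fin (S.arity f) → A),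
    toLinearMap (MultAlg.op (R := R) f a) = MultAlg.op (R := R) f (fun i => toLinearMap (a i))

/-- The kernel ideal of a homomorphism. -/
abbrev MultHom.ker {R : Type*} [Ring R] {S : MultSig} {A Q : Type*}
    [AddCommGroup A] [Module R A] [MultAlg R S A] [AddCommGroup Q] [Module R Q] [MultAlg R S Q]
    (π : MultHom R S A Q) : Submodule R A :=
  LinearMap.ker π.toLinearMap

theorem MultHom.op_mem_ker {R : Type*} [Ring R] {S : MultSig} {A Q : Type*}
    [AddCommGroup A] [Module R A] [MultAlg R S A] [AddCommGroup Q] [Module R Q] [MultAlg R S Q]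
    (π : MultHom R S A Q) (f : S.Op) (a : Fin (S.arity f) → A) (i : Fin (S.arity f))
    (hi : a i ∈ π.ker) : MultAlg.op (R := R) f a ∈ π.ker := by
  rw [LinearMap.mem_ker, π.map_op]
  exact (MultAlg.op (R := R) f).map_coord_zero i hi

/-- The kernel ideal as an algebra, with the restricted operations. -/
instance MultHom.instMultAlgKer {R : Type*} [Ring R] {S : MultSig} {A Q : Type*}
    [AddCommGroup A] [Module R A] [MultAlg R S A] [AddCommGroup Q] [Module R Q] [MultAlg R S Q]
    (π : MultHom R S A Q) : MultAlg R S π.ker where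
  op f := ((MultAlg.op (R := R) (A := A) f).compLinearMap (fun _ => π.ker.subtype)).codRestrict
    π.ker (fun v => π.op_mem_ker f _ ⟨0, S.arity_pos f⟩ (v ⟨0, S.arity_pos f⟩).2)

/-- `Aut A`: the group (under composition) of automorphisms of a module with multilinear
operations. -/
def MultAut (R : Type*) [Ring R] (S : MultSig) (A : Type*)
    [AddCommGroup A] [Module R A] [MultAlg R S A] : Subgroup (A ≃ₗ[R] A) where
  carrier := {φ | ∀ (f : S.Op) (a : Fin (S.arity f) → A),
    φ (MultAlg.op (R := R) f a) = MultAlg.op (R := R) f (fun i => φ (a i))}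
  mul_mem' {φ χ} hφ hχ f a := by
    rw [LinearEquiv.mul_apply, hχ f a, hφ f]
    rfl
  one_mem' _ _ := rfl
  inv_mem' {φ} hφ f a := by
    apply φ.injective
    have h1 : ∀ b : A, φ (φ⁻¹ b) = b := fun b => φ.apply_symm_apply b
    rw [h1, hφ f]
    simp only [h1]

/-- `Aut_I A`: the automorphisms `φ` of `A` with `φ(I) = I`, where `I` is the kernel of `π`. -/
def MultAutKer {R : Type*} [Ring R] {S : MultSig} {A Q : Type*}
    [AddCommGroup A] [Module R A] [MultAlg R S A] [AddCommGroup Q] [Module R Q] [MultAlg R S Q]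
    (π : MultHom R S A Q) : Subgroup (MultAut R S A) where
  carrier := {φ | ∀ a : A, φ.1 a ∈ π.ker ↔ a ∈ π.ker}
  mul_mem' {φ χ} hφ hχ a := (hφ (χ.1 a)).trans (hχ a)
  one_mem' _ := Iff.rfl
  inv_mem' {φ} hφ a := by
    have h1 : φ.1 ((φ⁻¹).1 a) = a := φ.1.apply_symm_apply a
    rw [← hφ ((φ⁻¹).1 a), h1]

/-! ### 2-cocycles and second cohomology -/

/-- `[n]^*`: the proper non-empty sets of argument places of the operation symbol `f`. -/
abbrev PropSub {S : MultSig} (f : S.Op) : Type :=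
  {s : Finset (Fin (S.arity f)) // s.Nonempty ∧ s ≠ Finset.univ}

/-- The data `(T_+, T_r, T_f, a(f,s))` of a factor system of `Q` with values in `I`. The action
term `a(f,s)` takes arguments from `Q` at the places outside `s` and from `I` at those in `s`. -/
@[ext]
structure FactorData (R : Type*) (S : MultSig) (Q I : Type*) where
  add : Q → Q → I
  smul : R → Q → I
  op : (f : S.Op) → (Fin (S.arity f) → Q) → I
  act : (f : S.Op) → (s : PropSub f) →
    ({i : Fin (S.arity f) // i ∉ s.1} → Q) → ({i : Fin (S.arity f) // i ∈ s.1} → I) → I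

section Cocycles

variable {R : Type*} [Ring R] {S : MultSig} {Q I : Type*}
  [AddCommGroup Q] [Module R Q] [MultAlg R S Q] [AddCommGroup I] [Module R I] [MultAlg R S I]

/-- `a(f,s)(x,a)` for full tuples `x` in `Q` and `a` in `I`. -/
def FactorData.actAt (T : FactorData R S Q I) (f : S.Op) (s : PropSub f)
    (x : Fin (S.arity f) → Q) (a : Fin (S.arity f) → I) : I :=
  T.act f s (fun i => x i) (fun i => a i)

/-- The algebra `I ⋊_T Q` on the set `I × Q`. -/
def FactorData.semidirect (T : FactorData R S Q I) : RawAlg R S (I × Q) where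
  zero := (0, 0)
  add p q := (p.1 + q.1 + T.add p.2 q.2, p.2 + q.2)
  smul r p := (r • p.1 + T.smul r p.2, r • p.2)
  op f p := (MultAlg.op (R := R) f (fun i => (p i).1)
      + ∑ s : PropSub f, T.actAt f s (fun i => (p i).2) (fun i => (p i).1)
      + T.op f (fun i => (p i).2),
    MultAlg.op (R := R) f (fun i => (p i).2))

/-- `T` is a 2-cocycle compatible with `V`: its action terms vanish when some argument is zero,
and `I ⋊_T Q` satisfies all identities of `V`. -/
structure FactorData.IsCocycle (V : MultVariety R S) (T : FactorData R S Q I) : Prop where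
  act_zero_left : ∀ (f : S.Op) (s : PropSub f) x a, (∃ i, x i = 0) → T.act f s x a = 0
  act_zero_right : ∀ (f : S.Op) (s : PropSub f) x a, (∃ i, a i = 0) → T.act f s x a = 0
  mem : V.Mem T.semidirect

/-- `h : Q → I` witnesses that `T` and `T'` are equivalent, i.e. that `T - T'` is the
2-coboundary of `h`. Here `s.piecewise a (h ∘ x)` is the tuple `h(x)` with its entries at the
places in `s` replaced by those of `a`. -/
structure FactorData.IsCobounding (T T' : FactorData R S Q I) (h : Q → I) : Prop where
  map_zero : h 0 = 0
  add : ∀ x y, T.add x y - T'.add x y = h x + h y - h (x + y)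
  smul : ∀ r x, T.smul r x - T'.smul r x = r • h x - h (r • x)
  op : ∀ (f : S.Op) (x : Fin (S.arity f) → Q),
    T.op f x - T'.op f x =
      ∑ s : PropSub f, (-1 : ℤ) ^ (1 + s.1.card) • T.actAt f s x (h ∘ x)
        + (-1 : ℤ) ^ (1 + S.arity f) • MultAlg.op (R := R) f (h ∘ x)
        - h (MultAlg.op (R := R) f x)
  act : ∀ (f : S.Op) (s : PropSub f) (x : Fin (S.arity f) → Q) (a : Fin (S.arity f) → I),
    T.actAt f s x a - T'.actAt f s x a =
      ∑ r : PropSub f with s.1 ⊂ r.1,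
          (-1 : ℤ) ^ (1 + (r.1.card - s.1.card)) • T.actAt f r x (s.1.piecewise a (h ∘ x))
        + (-1 : ℤ) ^ (1 + (S.arity f - s.1.card)) •
            MultAlg.op (R := R) f (s.1.piecewise a (h ∘ x))

variable (Q I) in
/-- `Z²_V(Q,I)`: the 2-cocycles compatible with `V`. -/
def Cocycle (V : MultVariety R S) : Type _ :=
  {T : FactorData R S Q I // T.IsCocycle V}

variable (Q I) in
/-- `H²_V(Q,I)`: the set of equivalence classes of 2-cocycles compatible with `V`. -/
def Cohomology (V : MultVariety R S) : Type _ :=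
  Quot (fun T T' : Cocycle Q I V => ∃ h : Q → I, T.1.IsCobounding T'.1 h)

/-- `d : Q → I` is a derivation with respect to the action terms of `T`. -/
structure FactorData.IsDerivation (T : FactorData R S Q I) (d : Q → I) : Prop where
  add : ∀ x y, d (x + y) = d x + d y
  smul : ∀ (r : R) x, d (r • x) = r • d x
  op : ∀ (f : S.Op) (x : Fin (S.arity f) → Q),
    d (MultAlg.op (R := R) f x) =
      ∑ s : PropSub f, T.actAt f s x (d ∘ x) + MultAlg.op (R := R) f (d ∘ x)
  act : ∀ (f : S.Op) (s : PropSub f) (x : Fin (S.arity f) → Q) (a : Fin (S.arity f) → I),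
    ∑ r : PropSub f with s.1 ⊂ r.1, T.actAt f r x (s.1.piecewise a (d ∘ x))
      + MultAlg.op (R := R) f (s.1.piecewise a (d ∘ x)) = 0

/-- The factor system `T^(σ,κ)`. -/
def FactorData.twist (T : FactorData R S Q I) (g : MultAut R S I × MultAut R S Q) :
    FactorData R S Q I where
  add x y := g.1.1 (T.add (g.2.1.symm x) (g.2.1.symm y))
  smul r x := g.1.1 (T.smul r (g.2.1.symm x))
  op f x := g.1.1 (T.op f (fun i => g.2.1.symm (x i)))
  act f s x a := g.1.1 (T.act f s (fun i => g.2.1.symm (x i)) (fun i => g.1.1.symm (a i)))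

theorem FactorData.IsCocycle.twist {V : MultVariety R S} {T : FactorData R S Q I}
    (hT : T.IsCocycle V) (g : MultAut R S I × MultAut R S Q) : (T.twist g).IsCocycle V where
  act_zero_left f s x a hx := by
    obtain ⟨i, hi⟩ := hx
    have := hT.act_zero_left f s (fun i => g.2.1.symm (x i)) (fun i => g.1.1.symm (a i))
      ⟨i, by simp [hi]⟩
    simp [FactorData.twist, this]
  act_zero_right f s x a ha := by
    obtain ⟨i, hi⟩ := ha
    have := hT.act_zero_right f s (fun i => g.2.1.symm (x i)) (fun i => g.1.1.symm (a i))
      ⟨i, by simp [hi]⟩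
    simp [FactorData.twist, this]
  mem := by
    have h1 : ∀ (f : S.Op) (a : Fin (S.arity f) → I), g.1.1.symm (MultAlg.op (R := R) f a)
        = MultAlg.op (R := R) f (fun i => g.1.1.symm (a i)) := (g.1⁻¹).2
    have h2 : ∀ (f : S.Op) (a : Fin (S.arity f) → Q), g.2.1.symm (MultAlg.op (R := R) f a)
        = MultAlg.op (R := R) f (fun i => g.2.1.symm (a i)) := (g.2⁻¹).2
    refine hT.mem.of_injective (fun p => (g.1.1.symm p.1, g.2.1.symm p.2)) ?_ ?_ ?_ ?_ ?_
    · intro p q h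
      simpa [Prod.ext_iff] using h
    · simp [FactorData.semidirect]
    · intro x y
      simp [FactorData.semidirect, FactorData.twist]
    · intro r x
      simp [FactorData.semidirect, FactorData.twist]
    · intro f x
      simp [FactorData.semidirect, FactorData.twist, FactorData.actAt, h1, h2]

/-- The action of `Aut I × Aut Q` on the 2-cocycles compatible with `V`. -/
def Cocycle.twist {V : MultVariety R S} (T : Cocycle Q I V)
    (g : MultAut R S I × MultAut R S Q) : Cocycle Q I V :=
  ⟨T.1.twist g, T.2.twist g⟩

/-- The class `[T]` of a 2-cocycle. -/
def Cocycle.cls {V : MultVariety R S} (T : Cocycle Q I V) : Cohomology Q I V :=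
  Quot.mk _ T

/-- The Wells map `W_T(σ,κ) = [T] - [T^(σ,κ)]`, a formal difference in the free abelian group
generated by the cohomology classes. -/
noncomputable def Cocycle.wells {V : MultVariety R S} (T : Cocycle Q I V)
    (g : MultAut R S I × MultAut R S Q) : FreeAbelianGroup (Cohomology Q I V) :=
  FreeAbelianGroup.of T.cls - FreeAbelianGroup.of (T.twist g).cls

end Cocycles

/-! ### The 2-cocycle associated to an extension -/

section Associated

variable {R : Type*} [Ring R] {S : MultSig} {A Q : Type*}
  [AddCommGroup A] [Module R A] [MultAlg R S A] [AddCommGroup Q] [Module R Q] [MultAlg R S Q]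

/-- A lifting of `π : A → Q`: a map `l : Q → A` with `π ∘ l = id` and `l 0 = 0`. -/
structure Lifting (π : MultHom R S A Q) where
  toFun : Q → A
  section_apply : ∀ x, π.toLinearMap (toFun x) = x
  map_zero : toFun 0 = 0

/-- The tuple with entries `l (x i)` at the places outside `s` and `a i` at those in `s`. -/
def Lifting.mix {π : MultHom R S A Q} (l : Lifting π) {n : ℕ} (s : Finset (Fin n))
    (x : {i : Fin n // i ∉ s} → Q) (a : {i : Fin n // i ∈ s} → π.ker) : Fin n → A :=
  fun i => if h : i ∈ s then (a ⟨i, h⟩ : A) else l.toFun (x ⟨i, h⟩)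

/-- The factor system defined by a lifting. -/
def Lifting.factorData {π : MultHom R S A Q} (l : Lifting π) : FactorData R S Q π.ker where
  add x y := ⟨l.toFun x + l.toFun y - l.toFun (x + y), by simp [l.section_apply]⟩
  smul r x := ⟨r • l.toFun x - l.toFun (r • x), by simp [l.section_apply]⟩
  op f x := ⟨MultAlg.op (R := R) f (fun i => l.toFun (x i)) - l.toFun (MultAlg.op (R := R) f x),
    by simp [l.section_apply, π.map_op]⟩
  act f s x a := ⟨MultAlg.op (R := R) f (l.mix s.1 x a), by
    obtain ⟨i, hi⟩ := s.2.1
    refine π.op_mem_ker f _ i ?_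
    simp only [Lifting.mix, hi, dif_pos]
    exact (a ⟨i, hi⟩).2⟩

theorem Lifting.op_expand {π : MultHom R S A Q} (l : Lifting π) (f : S.Op)
    (x : Fin (S.arity f) → Q) (a : Fin (S.arity f) → π.ker) :
    MultAlg.op (R := R) f (fun i => (a i : A) + l.toFun (x i)) =
      MultAlg.op (R := R) f (fun i => (a i : A))
        + ∑ s : PropSub f, MultAlg.op (R := R) f (l.mix s.1 (fun i => x i) (fun i => a i))
        + MultAlg.op (R := R) f (fun i => l.toFun (x i)) := by
  classical
  have h1 := (MultAlg.op (R := R) (A := A) f).map_add_univ (fun i => (a i : A))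
    (fun i => l.toFun (x i))
  have h2 : ((fun i => (a i : A)) + fun i => l.toFun (x i)) =
      fun i => (a i : A) + l.toFun (x i) := rfl
  rw [h2] at h1
  have hne : (∅ : Finset (Fin (S.arity f))) ≠ Finset.univ := by
    intro h
    have : (⟨0, S.arity_pos f⟩ : Fin (S.arity f)) ∈ (∅ : Finset (Fin (S.arity f))) := by
      rw [h]; exact Finset.mem_univ _
    simp at this
  have h3 : ∀ s : PropSub f, l.mix s.1 (fun i => x i) (fun i => a i) =
      s.1.piecewise (fun i => (a i : A)) (fun i => l.toFun (x i)) := by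
    intro s
    funext i
    by_cases h : i ∈ s.1 <;> simp [Lifting.mix, h]
  simp only [h3]
  rw [h1, ← Finset.add_sum_erase _ _ (Finset.mem_univ Finset.univ),
    ← Finset.add_sum_erase _ _ (Finset.mem_erase.2 ⟨hne, Finset.mem_univ _⟩),
    Finset.piecewise_univ, Finset.piecewise_empty,
    ← Finset.sum_subtype (p := fun s : Finset (Fin (S.arity f)) => s.Nonempty ∧ s ≠ Finset.univ)
      ((Finset.univ.erase Finset.univ).erase ∅)
      (fun s => by simp [Finset.nonempty_iff_ne_empty])
      (fun s => MultAlg.op (R := R) f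
        (s.piecewise (fun i => (a i : A)) (fun i => l.toFun (x i))))]
  abel

theorem Lifting.isCocycle {π : MultHom R S A Q} (l : Lifting π) {V : MultVariety R S}
    (hA : V.Mem (MultAlg.toRaw R S A)) : l.factorData.IsCocycle V where
  act_zero_left f s x a hx := by
    obtain ⟨i, hi⟩ := hx
    apply Subtype.ext
    refine (MultAlg.op (R := R) (A := A) f).map_coord_zero i.1 ?_
    simp [Lifting.mix, i.2, hi, l.map_zero]
  act_zero_right f s x a ha := by
    obtain ⟨i, hi⟩ := ha
    apply Subtype.ext
    refine (MultAlg.op (R := R) (A := A) f).map_coord_zero i.1 ?_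
    simp [Lifting.mix, i.2, hi]
  mem := by
    refine hA.of_injective (fun p => (p.1 : A) + l.toFun p.2) ?_ ?_ ?_ ?_ ?_
    · rintro ⟨a, x⟩ ⟨b, y⟩ h
      have hx : x = y := by
        have := congrArg π.toLinearMap h
        simpa [l.section_apply] using this
      subst hx
      simpa using h
    · simp [FactorData.semidirect, MultAlg.toRaw, l.map_zero]
    · intro p q
      simp only [FactorData.semidirect, MultAlg.toRaw, Lifting.factorData, Submodule.coe_add]
      abel
    · intro r p
      simp only [FactorData.semidirect, MultAlg.toRaw, Lifting.factorData, Submodule.coe_add,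
        Submodule.coe_smul, smul_add]
      abel
    · intro f p
      have h := l.op_expand f (fun i => (p i).2) (fun i => (p i).1)
      simp only [FactorData.semidirect, MultAlg.toRaw, h, Lifting.factorData, Submodule.coe_add,
        Submodule.coe_sum, FactorData.actAt]
      have h2 : ((MultAlg.op (R := R) f (fun i => (p i).1) : π.ker) : A)
        = MultAlg.op (R := R) f (fun i => ((p i).1 : A)) := rfl
      rw [h2]
      abel

/-- The 2-cocycle defined by a lifting, associated to the extension `π : A → Q` with `A ∈ V`. -/
def Lifting.cocycle {π : MultHom R S A Q} (l : Lifting π) {V : MultVariety R S}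
    (hA : V.Mem (MultAlg.toRaw R S A)) : Cocycle Q π.ker V :=
  ⟨l.factorData, l.isCocycle hA⟩

end Associated

/-! ### Expansion of multilinear maps -/

/-! Everything reduces to one notion, `FactorData.Realized`: a factor system `T` is computed inside
an algebra from a homomorphism `j` on `I` and a map `l` on `Q`. If `T` is realized by `j`, `l` with
`j` injective, then the signed coboundary formulas are exactly the inclusion-exclusion expansion of
`f` on the tuple `l - j ∘ h`. Hence `h` cobounds `T - T'` if and only if `T'` is realized by `l - j
∘ h` (`isCobounding_iff`). So, once `T` comes from a lifting of `π`, its class consists of the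
cocycles that come from liftings of `π`.

Exactness at `Aut I × Aut Q`: the generators of a free abelian group are distinct, so `W_T(σ,κ) = 0`
means `[T] = [T^(σ,κ)]`, that is, `T^(σ,κ)` comes from some lifting `l'`. If `φ` extends `(σ,κ)`,
then `φ ∘ l ∘ κ⁻¹` is such a lifting. Conversely, given `l'`, the map `i + l x ↦ σ i + l' (κ x)` is
an automorphism, because both cocycles describe the operations of `A` in these normal forms.

Exactness at `Aut_I A`: an automorphism that is the identity on `I` and on `Q` has the form `a ↦ a +
d (π a)`. Expanding `f` by multilinearity shows that such a map preserves the operations precisely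
when `d` is a derivation (`isDerivation_iff`). -/

theorem MultilinearMap.map_piecewise_const_add {R ι M N : Type*} [Ring R] [Fintype ι]
    [DecidableEq ι] [AddCommGroup M] [Module R M] [AddCommGroup N] [Module R N]
    (g : MultilinearMap R (fun _ : ι => M) N) (s : Finset ι) (a w u : ι → M) :
    g (s.piecewise a (w + u)) =
      ∑ r : Finset ι with s ⊆ r, g (r.piecewise (s.piecewise a w) u) := by
  have h : s.piecewise a (w + u) = s.piecewise a w + s.piecewise (0 : ι → M) u := by
    ext i
    by_cases hi : i ∈ s <;> simp [hi]
  rw [h, g.map_add_univ, Finset.sum_filter]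
  refine Finset.sum_congr rfl fun r _ => ?_
  split_ifs with hr
  · congr 1
    ext i
    by_cases hi : i ∈ r
    · simp [hi]
    · have : i ∉ s := fun h => hi (hr h)
      simp [hi, this]
  · obtain ⟨i, his, hir⟩ := Finset.not_subset.1 hr
    exact g.map_coord_zero i (by simp [his, hir])

/-- Source of the coboundary signs: the `r.card - s.card` places of `r \ s` carry `-v`, and each
contributes a factor `-1`. -/
theorem MultilinearMap.map_piecewise_sub {R ι M N : Type*} [Ring R] [Fintype ι]
    [DecidableEq ι] [AddCommGroup M] [Module R M] [AddCommGroup N] [Module R N]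
    (g : MultilinearMap R (fun _ : ι => M) N) (s : Finset ι) (a u v : ι → M) :
    g (s.piecewise a (u - v)) = ∑ r : Finset ι with s ⊆ r,
      (-1 : ℤ) ^ (r.card - s.card) • g (r.piecewise (s.piecewise a v) u) := by
  rw [sub_eq_neg_add, g.map_piecewise_const_add]
  refine Finset.sum_congr rfl fun r hr => ?_
  replace hr := (Finset.mem_filter.1 hr).2
  -- Pulling out several scalars at once needs commuting scalars. `R` may be noncommutative, so the
  -- signs are taken in `ℤ`.
  have h := (g.restrictScalars ℤ).map_piecewise_smul (fun _ => -1)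
    (r.piecewise (s.piecewise a v) u) (r \ s)
  rw [Finset.prod_const, Finset.card_sdiff_of_subset hr] at h
  refine Eq.trans ?_ h
  rw [MultilinearMap.coe_restrictScalars]
  congr 1
  ext i
  by_cases hi : i ∈ r <;> by_cases hi' : i ∈ s <;> simp [hi, hi']

theorem PropSub.sum_finset {S : MultSig} {f : S.Op} {M : Type*} [AddCommMonoid M]
    (F : Finset (Fin (S.arity f)) → M) :
    ∑ r, F r = F ∅ + (∑ r : PropSub f, F r.1 + F Finset.univ) := by
  -- For a nullary symbol the two extreme terms would coincide; positive arity rules this out.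
  have hne : (∅ : Finset (Fin (S.arity f))) ≠ Finset.univ := fun h =>
    Finset.notMem_empty (⟨0, S.arity_pos f⟩ : Fin (S.arity f)) (h ▸ Finset.mem_univ _)
  rw [← Finset.add_sum_erase _ _ (Finset.mem_univ ∅),
    ← Finset.sum_erase_add _ _ (Finset.mem_erase.2 ⟨hne.symm, Finset.mem_univ _⟩),
    Finset.sum_subtype ((Finset.univ.erase ∅).erase Finset.univ)
      (p := fun s : Finset (Fin (S.arity f)) => s.Nonempty ∧ s ≠ Finset.univ)
      (fun s => by simp [Finset.nonempty_iff_ne_empty, and_comm])]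

theorem PropSub.sum_supersets {S : MultSig} {f : S.Op} {M : Type*} [AddCommMonoid M]
    (s : PropSub f) (F : Finset (Fin (S.arity f)) → M) :
    ∑ r : Finset (Fin (S.arity f)) with s.1 ⊆ r, F r =
      F s.1 + (∑ r : PropSub f with s.1 ⊂ r.1, F r.1 + F Finset.univ) := by
  have h1 : ∑ r : PropSub f with s.1 ⊆ r.1, F r.1 =
      F s.1 + ∑ r : PropSub f with s.1 ⊂ r.1, F r.1 := by
    rw [← Finset.add_sum_erase (a := s) _ _ (by simp)]
    congr 2
    ext r
    simp [ssubset_iff_subset_ne, and_comm, eq_comm, Subtype.ext_iff]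
  rw [Finset.sum_filter, PropSub.sum_finset, if_neg, if_pos (Finset.subset_univ _), zero_add,
    ← Finset.sum_filter, h1, add_assoc]
  rw [Finset.subset_empty]
  exact s.2.1.ne_empty

/-! ### Factor systems computed in an algebra, and coboundaries as changes of lifting -/

section Realized

variable {R : Type*} [Ring R] {S : MultSig} {A Q I : Type*}
  [AddCommGroup A] [Module R A] [MultAlg R S A] [AddCommGroup Q] [Module R Q] [MultAlg R S Q]
  [AddCommGroup I] [Module R I] [MultAlg R S I]

/-- The factor system `T` is computed in the algebra `A` from the map `l : Q → A` and the
homomorphism `j : I → A`. -/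
structure FactorData.Realized (T : FactorData R S Q I) (j : I →ₗ[R] A) (l : Q → A) : Prop where
  map_op : ∀ (f : S.Op) (a : Fin (S.arity f) → I),
    j (MultAlg.op (R := R) f a) = MultAlg.op (R := R) f (j ∘ a)
  add : ∀ x y, j (T.add x y) = l x + l y - l (x + y)
  smul : ∀ r x, j (T.smul r x) = r • l x - l (r • x)
  op : ∀ (f : S.Op) (x : Fin (S.arity f) → Q),
    j (T.op f x) = MultAlg.op (R := R) f (l ∘ x) - l (MultAlg.op (R := R) f x)
  act : ∀ (f : S.Op) (s : PropSub f) (x : Fin (S.arity f) → Q) (a : Fin (S.arity f) → I),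
    j (T.actAt f s x a) = MultAlg.op (R := R) f (s.1.piecewise (j ∘ a) (l ∘ x))

namespace FactorData.Realized

variable {T T' : FactorData R S Q I} {j : I →ₗ[R] A} {l : Q → A}

/-- This is the formula for the operations of `I ⋊_T Q`, read in `A` for elements in the normal form
`j a + l x`. -/
theorem op_add (hT : T.Realized j l) (f : S.Op) (x : Fin (S.arity f) → Q)
    (a : Fin (S.arity f) → I) :
    MultAlg.op (R := R) f (j ∘ a + l ∘ x) =
      j (MultAlg.op (R := R) f a + ∑ s : PropSub f, T.actAt f s x a + T.op f x)
        + l (MultAlg.op (R := R) f x) := by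
  rw [MultilinearMap.map_add_univ, PropSub.sum_finset]
  simp only [map_add, map_sum, hT.map_op, hT.act, hT.op, Finset.piecewise_univ,
    Finset.piecewise_empty]
  abel

theorem comp_piecewise {B C : Type*} {ι : Type*} [DecidableEq ι] (g : B → C) (s : Finset ι)
    (a b : ι → B) : g ∘ s.piecewise a b = s.piecewise (g ∘ a) (g ∘ b) := by
  ext i
  by_cases hi : i ∈ s <;> simp [hi]

theorem op_sub (hT : T.Realized j l) (h : Q → I) (f : S.Op) (x : Fin (S.arity f) → Q) :
    MultAlg.op (R := R) f ((fun x => l x - j (h x)) ∘ x) =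
      MultAlg.op (R := R) f (l ∘ x) -
      j (∑ s : PropSub f, (-1 : ℤ) ^ (1 + s.1.card) • T.actAt f s x (h ∘ x)
        + (-1 : ℤ) ^ (1 + S.arity f) • MultAlg.op (R := R) f (h ∘ x)) := by
  have h1 := (MultAlg.op (R := R) (A := A) f).map_piecewise_sub ∅ (l ∘ x) (l ∘ x) (j ∘ h ∘ x)
  simp only [Finset.piecewise_empty, Finset.empty_subset, Finset.filter_true] at h1
  rw [PropSub.sum_finset] at h1
  refine h1.trans ?_
  simp only [map_add, map_neg, map_sum, map_zsmul, hT.map_op, hT.act, Finset.piecewise_univ,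
    Finset.piecewise_empty, pow_add, pow_one, neg_one_mul, neg_smul, Finset.sum_neg_distrib,
    Finset.card_empty, Nat.sub_zero, pow_zero, one_smul, Finset.card_univ, Fintype.card_fin]
  abel

/-- In the expansion over `r ⊇ s`, the term `r = s` is the old action term; the terms `r ⊋ s`,
including the full set, form the coboundary. -/
theorem act_sub (hT : T.Realized j l) (h : Q → I) (f : S.Op) (s : PropSub f)
    (x : Fin (S.arity f) → Q) (a : Fin (S.arity f) → I) :
    MultAlg.op (R := R) f (s.1.piecewise (j ∘ a) ((fun x => l x - j (h x)) ∘ x)) =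
      j (T.actAt f s x a - (∑ r : PropSub f with s.1 ⊂ r.1,
          (-1 : ℤ) ^ (1 + (r.1.card - s.1.card)) • T.actAt f r x (s.1.piecewise a (h ∘ x))
        + (-1 : ℤ) ^ (1 + (S.arity f - s.1.card)) •
            MultAlg.op (R := R) f (s.1.piecewise a (h ∘ x)))) := by
  have h1 := (MultAlg.op (R := R) (A := A) f).map_piecewise_sub s.1 (j ∘ a) (l ∘ x) (j ∘ h ∘ x)
  rw [PropSub.sum_supersets] at h1
  have h2 : s.1.piecewise (s.1.piecewise (j ∘ a) (j ∘ h ∘ x)) (l ∘ x) =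
      s.1.piecewise (j ∘ a) (l ∘ x) := by
    ext i
    by_cases hi : i ∈ s.1 <;> simp [hi]
  refine h1.trans ?_
  simp only [map_add, map_sub, map_neg, map_sum, map_zsmul, hT.map_op, hT.act, Finset.piecewise_univ,
    comp_piecewise, pow_add, pow_one, neg_one_mul, neg_smul, Finset.sum_neg_distrib, h2,
    Nat.sub_self, pow_zero, one_smul, Finset.card_univ, Fintype.card_fin]
  abel

/-- The explicit equivalence of factor systems becomes a change of lifting. Each clause compares a
value computed from `l` with the same value computed from `l - j ∘ h`; injectivity of `j` brings the
comparison back to `I`. -/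
theorem isCobounding_iff (hT : T.Realized j l) (hj : Function.Injective j) {h : Q → I}
    (h0 : h 0 = 0) : T.IsCobounding T' h ↔ T'.Realized j (fun x => l x - j (h x)) := by
  constructor
  · intro H
    refine ⟨hT.map_op, fun x y => ?_, fun r x => ?_, fun f x => ?_, fun f s x a => ?_⟩
    · rw [← sub_sub_cancel (T.add x y) (T'.add x y), H.add]
      simp only [map_sub, map_add, hT.add]
      abel
    · rw [← sub_sub_cancel (T.smul r x) (T'.smul r x), H.smul]
      simp only [map_sub, map_smul, hT.smul, smul_sub]
      abel
    · rw [hT.op_sub, ← sub_sub_cancel (T.op f x) (T'.op f x), H.op, map_sub, map_sub, hT.op]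
      abel
    · rw [hT.act_sub, ← sub_sub_cancel (T.actAt f s x a) (T'.actAt f s x a), H.act]
  · intro H
    refine ⟨h0, fun x y => hj ?_, fun r x => hj ?_, fun f x => hj ?_, fun f s x a => hj ?_⟩
    · simp only [map_sub, map_add, hT.add, H.add]
      abel
    · simp only [map_sub, map_smul, hT.smul, H.smul, smul_sub]
      abel
    · have h1 := H.op f x
      rw [hT.op_sub] at h1
      rw [map_sub, map_sub, h1, hT.op]
      abel
    · have h1 := H.act f s x a
      rw [hT.act_sub] at h1
      rw [map_sub, h1, ← map_sub, sub_sub_cancel]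

end FactorData.Realized

end Realized

/-! ### Members of a variety as modules with multilinear operations -/

theorem MTerm.eval_update {R : Type*} {S : MultSig} {X : Type*} {B : RawAlg R S X}
    (f : S.Op) (i : Fin (S.arity f)) (t : MTerm R S) (v : ℕ → X) :
    (fun k => (Function.update (fun j : Fin (S.arity f) => MTerm.var (j : ℕ)) i t k).eval B v) =
      Function.update (fun j : Fin (S.arity f) => v j) i (t.eval B v) := by
  ext k
  by_cases hk : k = i
  · subst hk; simp
  · simp [hk, MTerm.eval]

section Member

variable {R : Type*} [Ring R] {S : MultSig} {V : MultVariety R S} {X : Type*} {B : RawAlg R S X}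

namespace MultVariety.Mem

theorem eval_base (hB : V.Mem B) {t s : MTerm R S} (h : BaseLaw R S t s) (v : ℕ → X) :
    t.eval B v = s.eval B v :=
  hB _ (V.base t s h) v

theorem zero_add (hB : V.Mem B) (x : X) : B.add B.zero x = x :=
  hB.eval_base .zero_add fun _ => x

theorem add_comm (hB : V.Mem B) (x y : X) : B.add x y = B.add y x :=
  hB.eval_base .add_comm fun n => if n = 0 then x else y

theorem zero_smul (hB : V.Mem B) (x : X) : B.smul 0 x = B.zero :=
  hB.eval_base .zero_smul fun _ => x

theorem one_smul (hB : V.Mem B) (x : X) : B.smul 1 x = x :=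
  hB.eval_base .one_smul fun _ => x

theorem add_smul (hB : V.Mem B) (r s : R) (x : X) :
    B.smul (r + s) x = B.add (B.smul r x) (B.smul s x) :=
  hB.eval_base (.add_smul r s) fun _ => x

theorem mul_smul (hB : V.Mem B) (r s : R) (x : X) :
    B.smul (r * s) x = B.smul r (B.smul s x) :=
  hB.eval_base (.mul_smul r s) fun _ => x

theorem smul_zero (hB : V.Mem B) (r : R) : B.smul r B.zero = B.zero := by
  rw [← hB.zero_smul B.zero, ← hB.mul_smul, mul_zero]

/-- The additive group of an algebra in a variety. -/
abbrev addCommGroup (hB : V.Mem B) : AddCommGroup X :=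
  letI : Zero X := ⟨B.zero⟩
  letI : Add X := ⟨B.add⟩
  letI : Neg X := ⟨B.smul (-1)⟩
  { AddGroup.ofLeftAxioms (G := X)
      (fun x y z => hB.eval_base .add_assoc fun n => if n = 0 then x else if n = 1 then y else z)
      hB.zero_add
      (fun x => by
        have h := hB.add_smul (-1) 1 x
        rw [neg_add_cancel, hB.zero_smul, hB.one_smul] at h
        exact h.symm) with
    add_comm := hB.add_comm }

/-- The module underlying an algebra in a variety. -/
abbrev module (hB : V.Mem B) : @Module R X _ hB.addCommGroup.toAddCommMonoid :=
  letI := hB.addCommGroup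
  { smul := B.smul
    one_smul := hB.one_smul
    mul_smul := hB.mul_smul
    smul_zero := hB.smul_zero
    smul_add := fun r x y => hB.eval_base (.smul_add r) fun n => if n = 0 then x else y
    add_smul := hB.add_smul
    zero_smul := hB.zero_smul }

theorem op_update_add (hB : V.Mem B) (f : S.Op) (i : Fin (S.arity f)) (p : Fin (S.arity f) → X)
    (x y : X) : B.op f (Function.update p i (B.add x y)) =
      B.add (B.op f (Function.update p i x)) (B.op f (Function.update p i y)) := by
  -- The variables below the arity name the tuple with `x` at place `i`; the variable numbered by
  -- the arity is the extra summand `y`.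
  have h := hB.eval_base (.op_add f i)
    fun n => if hn : n < S.arity f then Function.update p i x ⟨n, hn⟩ else y
  simp only [MTerm.eval, MTerm.eval_update] at h
  simpa using h

theorem op_update_smul (hB : V.Mem B) (f : S.Op) (i : Fin (S.arity f))
    (p : Fin (S.arity f) → X) (r : R) (x : X) :
    B.op f (Function.update p i (B.smul r x)) = B.smul r (B.op f (Function.update p i x)) := by
  -- The default value is never read, as this law uses only variables below the arity.
  have h := hB.eval_base (.op_smul f i r)
    fun n => if hn : n < S.arity f then Function.update p i x ⟨n, hn⟩ else x
  simp only [MTerm.eval, MTerm.eval_update] at h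
  simpa using h

/-- The multilinear operations of an algebra in a variety. -/
abbrev multAlg (hB : V.Mem B) :
    @MultAlg R _ S X hB.addCommGroup hB.module :=
  letI := hB.addCommGroup
  letI := hB.module
  { op := fun f =>
    { toFun := B.op f
      map_update_add' := fun {inst} p i x y => by
        rw [Subsingleton.elim inst (instDecidableEqFin _)]
        exact hB.op_update_add f i p x y
      map_update_smul' := fun {inst} p i r x => by
        rw [Subsingleton.elim inst (instDecidableEqFin _)]
        exact hB.op_update_smul f i p r x } }

end MultVariety.Mem

end Member

/-! ### Every cocycle is realized in its own extension `I ⋊_T Q` -/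

section Semidirect

variable {R : Type*} [Ring R] {S : MultSig} {V : MultVariety R S} {Q I : Type*}
  [AddCommGroup Q] [Module R Q] [MultAlg R S Q] [AddCommGroup I] [Module R I] [MultAlg R S I]

theorem PropSub.exists_notMem {S : MultSig} {f : S.Op} (s : PropSub f) : ∃ k, k ∉ s.1 := by
  by_contra! h
  exact s.2.2 (Finset.eq_univ_iff_forall.2 h)

/-- The carrier `I × Q` of `I ⋊_T Q`. -/
def Cocycle.Ext (_T : Cocycle Q I V) : Type _ := I × Q

namespace Cocycle

variable (T : Cocycle Q I V)

instance : AddCommGroup T.Ext := T.2.mem.addCommGroup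
instance : Module R T.Ext := T.2.mem.module
instance : MultAlg R S T.Ext := T.2.mem.multAlg

theorem add_zero_left (x : Q) : T.1.add 0 x = 0 := by
  have h := congrArg Prod.fst (T.2.mem.zero_add (0, x))
  simpa [FactorData.semidirect] using h

theorem smul_zero (r : R) : T.1.smul r 0 = 0 := by
  have h := congrArg Prod.fst (T.2.mem.smul_zero r)
  simpa [FactorData.semidirect] using h

theorem actAt_eq_zero (f : S.Op) (s : PropSub f) (x : Fin (S.arity f) → Q)
    (a : Fin (S.arity f) → I) {i : Fin (S.arity f)} (hx : x i = 0) (ha : a i = 0) :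
    T.1.actAt f s x a = 0 := by
  by_cases hi : i ∈ s.1
  · exact T.2.act_zero_right f s _ _ ⟨⟨i, hi⟩, ha⟩
  · exact T.2.act_zero_left f s _ _ ⟨⟨i, hi⟩, hx⟩

/-- This normalization is forced by multilinearity in `I ⋊_T Q`: on the tuple of pairs `(0, x k)`
the operation vanishes, and so do all summands of its first component other than `T_f`. -/
theorem op_eq_zero (f : S.Op) (x : Fin (S.arity f) → Q) {i : Fin (S.arity f)} (hx : x i = 0) :
    T.1.op f x = 0 := by
  have h := (MultAlg.op (R := R) (A := T.Ext) f).map_coord_zero (m := fun k => ((0, x k) : I × Q))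
    i (by rw [hx]; rfl)
  replace h := congrArg Prod.fst h
  change MultAlg.op (R := R) f (fun _ => (0 : I)) + ∑ s : PropSub f, T.1.actAt f s x (fun _ => 0)
    + T.1.op f x = 0 at h
  rwa [(MultAlg.op (R := R) (A := I) f).map_coord_zero i rfl,
    Finset.sum_eq_zero fun s _ => T.actAt_eq_zero f s x _ hx rfl, _root_.zero_add,
    _root_.zero_add] at h

/-- The embedding of `I` in `I ⋊_T Q`. -/
def inl : I →ₗ[R] T.Ext where
  toFun a := ((a, 0) : I × Q)
  map_add' a b := by
    change _ = ((a + b + T.1.add 0 0, 0 + 0) : I × Q)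
    rw [add_zero_left, add_zero, add_zero]
  map_smul' r a := by
    change _ = ((r • a + T.1.smul r 0, r • 0) : I × Q)
    rw [T.smul_zero, add_zero, _root_.smul_zero]

/-- The lifting of `Q` in `I ⋊_T Q`. -/
def inr (x : Q) : T.Ext := ((0, x) : I × Q)

theorem inl_injective : Function.Injective T.inl := fun _ _ h => congrArg Prod.fst h

theorem inl_add_inr (a : I) (x : Q) : T.inl a + T.inr x = ((a, x) : I × Q) := by
  change ((a + 0 + T.1.add 0 x, 0 + x) : I × Q) = _
  rw [add_zero_left, add_zero, add_zero, _root_.zero_add]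

theorem op_ext (f : S.Op) (a : Fin (S.arity f) → I) (x : Fin (S.arity f) → Q) :
    MultAlg.op (R := R) (A := T.Ext) f (fun i => ((a i, x i) : I × Q)) =
      T.inl (MultAlg.op (R := R) f a + ∑ s : PropSub f, T.1.actAt f s x a + T.1.op f x)
        + T.inr (MultAlg.op (R := R) f x) := by
  rw [inl_add_inr]
  rfl

/-- Each entry of the tuples evaluated here is in `I` or in the image of `inr`, so its other
component is zero. These zeros kill every summand of the operation except the one wanted. -/
theorem realized : T.1.Realized T.inl T.inr where
  map_op f a := by
    have h := T.op_ext f a 0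
    rw [(MultAlg.op (R := R) (A := Q) f).map_coord_zero ⟨0, S.arity_pos f⟩ rfl,
      T.op_eq_zero f 0 (i := ⟨0, S.arity_pos f⟩) rfl] at h
    rw [Finset.sum_eq_zero fun s _ => ?_, add_zero, add_zero] at h
    · exact (h.trans (add_zero _)).symm
    · obtain ⟨k, hk⟩ := PropSub.exists_notMem s
      exact T.2.act_zero_left f s _ _ ⟨⟨k, hk⟩, rfl⟩
  add x y := by
    rw [eq_sub_iff_add_eq, inl_add_inr]
    change _ = ((0 + 0 + T.1.add x y, x + y) : I × Q)
    rw [add_zero, _root_.zero_add]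
  smul r x := by
    rw [eq_sub_iff_add_eq, inl_add_inr]
    change _ = ((r • 0 + T.1.smul r x, r • x) : I × Q)
    rw [_root_.smul_zero, _root_.zero_add]
  op f x := by
    have h := T.op_ext f 0 x
    rw [(MultAlg.op (R := R) (A := I) f).map_coord_zero ⟨0, S.arity_pos f⟩ rfl] at h
    rw [Finset.sum_eq_zero fun s _ => ?_, add_zero, _root_.zero_add] at h
    · exact eq_sub_of_add_eq h.symm
    · obtain ⟨k, hk⟩ := s.2.1
      exact T.2.act_zero_right f s _ _ ⟨⟨k, hk⟩, rfl⟩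
  act f s x a := by
    obtain ⟨i, hi⟩ := s.2.1
    obtain ⟨k, hk⟩ := PropSub.exists_notMem s
    have h := T.op_ext f (s.1.piecewise a 0) (s.1.piecewise 0 x)
    rw [(MultAlg.op (R := R) (A := I) f).map_coord_zero k (by simp [hk]),
      (MultAlg.op (R := R) (A := Q) f).map_coord_zero i (by simp [hi]),
      T.op_eq_zero f _ (i := i) (by simp [hi]),
      Finset.sum_eq_single s (fun r _ hr => ?_) (by simp), add_zero, _root_.zero_add] at h
    · have h1 : T.1.actAt f s (s.1.piecewise 0 x) (s.1.piecewise a 0) = T.1.actAt f s x a := by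
        unfold FactorData.actAt
        congr 1 <;> ext ⟨i, hi⟩ <;> simp [hi]
      have h2 : (fun i => ((s.1.piecewise a 0 i, s.1.piecewise 0 x i) : I × Q)) =
          s.1.piecewise (T.inl ∘ a) (T.inr ∘ x) := by
        ext i : 1
        by_cases hi : i ∈ s.1 <;> simp only [hi, Finset.piecewise_eq_of_mem,
          Finset.piecewise_eq_of_notMem, not_false_eq_true] <;> rfl
      rw [h1] at h
      rw [← h2]
      exact (h.trans (add_zero _)).symm
    -- A set `r ≠ s` differs from `s` at some place `m`: if `m` is in `s` only, `a(f,r)` reads the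
    -- zero of `Q` there; if in `r` only, the zero of `I`.
    · obtain ⟨m, hm⟩ : ∃ m, ¬ (m ∈ r.1 ↔ m ∈ s.1) := by
        by_contra! h
        exact hr (Subtype.ext (Finset.ext h))
      by_cases hms : m ∈ s.1
      · have hmr : m ∉ r.1 := fun h => hm (iff_of_true h hms)
        exact T.2.act_zero_left f r _ _ ⟨⟨m, hmr⟩, by simp [hms]⟩
      · have hmr : m ∈ r.1 := by_contra fun h => hm (iff_of_false h hms)
        exact T.2.act_zero_right f r _ _ ⟨⟨m, hmr⟩, by simp [hms]⟩

end Cocycle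

/-- The defining formulas use the action terms of `T` only, so symmetry is not formal. In `I ⋊_T Q`
it amounts to undoing the change of lifting. -/
theorem FactorData.IsCobounding.symm {T T' : Cocycle Q I V} {h : Q → I}
    (H : T.1.IsCobounding T'.1 h) : T'.1.IsCobounding T.1 (fun x => -h x) := by
  have h1 := (T.realized.isCobounding_iff T.inl_injective H.map_zero).1 H
  rw [h1.isCobounding_iff T.inl_injective (by simp [H.map_zero])]
  simpa using T.realized

end Semidirect

/-! ### Derivations as shifts that preserve the operations -/

section Derivation

variable {R : Type*} [Ring R] {S : MultSig} {A Q I : Type*}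
  [AddCommGroup A] [Module R A] [MultAlg R S A] [AddCommGroup Q] [Module R Q] [MultAlg R S Q]
  [AddCommGroup I] [Module R I] [MultAlg R S I]

namespace FactorData.Realized

variable {T : FactorData R S Q I} {j : I →ₗ[R] A} {l : Q → A}

/-- The correction term is the expression that the second derivation condition requires to vanish.
-/
theorem act_add (hT : T.Realized j l) (d : Q → I) (f : S.Op) (s : PropSub f)
    (x : Fin (S.arity f) → Q) (a : Fin (S.arity f) → I) :
    MultAlg.op (R := R) f (s.1.piecewise (j ∘ a) (j ∘ d ∘ x + l ∘ x)) =
      MultAlg.op (R := R) f (s.1.piecewise (j ∘ a) (l ∘ x)) +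
      j (∑ r : PropSub f with s.1 ⊂ r.1, T.actAt f r x (s.1.piecewise a (d ∘ x))
        + MultAlg.op (R := R) f (s.1.piecewise a (d ∘ x))) := by
  have h2 : s.1.piecewise (s.1.piecewise (j ∘ a) (j ∘ d ∘ x)) (l ∘ x) =
      s.1.piecewise (j ∘ a) (l ∘ x) := by
    ext i
    by_cases hi : i ∈ s.1 <;> simp [hi]
  rw [MultilinearMap.map_piecewise_const_add, PropSub.sum_supersets, h2]
  simp only [map_add, map_sum, hT.map_op, hT.act, Finset.piecewise_univ, comp_piecewise]

/-- Derivations are the linear maps `d` for which `a ↦ a + d (π a)` preserves the operations. -/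
theorem isDerivation_iff (hT : T.Realized j l) (hj : Function.Injective j) (hl : l 0 = 0)
    {d : Q → I} : T.IsDerivation d ↔
      (∀ x y, d (x + y) = d x + d y) ∧ (∀ (r : R) x, d (r • x) = r • d x) ∧
      ∀ (f : S.Op) (x : Fin (S.arity f) → Q) (a : Fin (S.arity f) → I),
        MultAlg.op (R := R) f (j ∘ (a + d ∘ x) + l ∘ x) =
          MultAlg.op (R := R) f (j ∘ a + l ∘ x) + j (d (MultAlg.op (R := R) f x)) := by
  have hadd : ∀ {n : ℕ} (a b : Fin n → I), j ∘ (a + b) = j ∘ a + j ∘ b :=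
    fun a b => funext fun i => map_add j (a i) (b i)
  constructor
  · intro H
    refine ⟨H.add, H.smul, fun f x a => ?_⟩
    have h0 := hT.op_add f x (d ∘ x)
    have hop := hT.op f x
    -- Both sides are expanded over the set of places that carry `j ∘ a`. Proper nonempty sets
    -- contribute equally by `H.act`, the full set trivially, and the empty set gives the term `j (d
    -- (f x))` by `H.op`.
    rw [hadd, add_assoc, MultilinearMap.map_add_univ, PropSub.sum_finset,
      MultilinearMap.map_add_univ, PropSub.sum_finset]
    simp only [hT.act_add, H.act, map_zero, add_zero, Finset.piecewise_empty,
      Finset.piecewise_univ]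
    rw [h0, H.op, map_add, hop, add_comm (MultAlg.op (R := R) f (d ∘ x))]
    abel
  · rintro ⟨hd, hs, H⟩
    refine ⟨hd, hs, fun f x => hj ?_, fun f s x a => hj ?_⟩
    · have h := H f x 0
      have h1 : j ∘ (0 : Fin (S.arity f) → I) = 0 := funext fun i => map_zero j
      rw [zero_add, h1, zero_add, hT.op_add, map_add, hT.op] at h
      rw [← add_right_inj (MultAlg.op (R := R) f (l ∘ x)), ← h,
        add_comm (∑ s : PropSub f, T.actAt f s x (d ∘ x))]
      abel
    · have hd0 : d 0 = 0 := by simpa using hd 0 0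
      -- The test tuple is `j ∘ a` on `s` and `l ∘ x` off `s`. Since `d 0 = 0`, only the places off
      -- `s` are shifted; since `s` is nonempty, `f` vanishes on the tuple in `Q`.
      have h := H f (s.1.piecewise 0 x) (s.1.piecewise a 0)
      obtain ⟨i, hi⟩ := s.2.1
      rw [(MultAlg.op (R := R) (A := Q) f).map_coord_zero i (by simp [hi]), hd0, map_zero,
        add_zero] at h
      have h1 : j ∘ (s.1.piecewise a 0 + d ∘ s.1.piecewise 0 x) + l ∘ s.1.piecewise 0 x =
          s.1.piecewise (j ∘ a) (j ∘ d ∘ x + l ∘ x) := by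
        ext k
        by_cases hk : k ∈ s.1 <;> simp [hk, hd0, hl]
      have h2 : j ∘ s.1.piecewise a 0 + l ∘ s.1.piecewise 0 x =
          s.1.piecewise (j ∘ a) (l ∘ x) := by
        ext k
        by_cases hk : k ∈ s.1 <;> simp [hk, hl]
      rw [h1, h2, hT.act_add, add_eq_left] at h
      rw [h, map_zero]

/-- The group of derivations. -/
def derivations (hT : T.Realized j l) (hj : Function.Injective j) (hl : l 0 = 0) :
    AddSubgroup (Q → I) where
  carrier := {d | T.IsDerivation d}
  add_mem' {d e} hd he := by
    simp only [Set.mem_ofPred_eq, hT.isDerivation_iff hj hl] at hd he ⊢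
    refine ⟨fun x y => ?_, fun r x => ?_, fun f x a => ?_⟩
    · rw [Pi.add_apply, hd.1 x y, he.1 x y]
      exact add_add_add_comm _ _ _ _
    · rw [Pi.add_apply, hd.2.1 r x, he.2.1 r x]
      exact (smul_add _ _ _).symm
    -- The shift by `d + e` is the shift by `d` followed by the shift by `e`.
    · have h := he.2.2 f x (a + d ∘ x)
      rw [hd.2.2, add_assoc a] at h
      rw [Pi.add_apply, map_add j, ← add_assoc, ← h]
      rfl
  zero_mem' := by
    simp only [Set.mem_ofPred_eq, hT.isDerivation_iff hj hl]
    refine ⟨fun x y => by simp, fun r x => by simp, fun f x a => ?_⟩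
    rw [Pi.zero_apply, map_zero, add_zero]
    exact congrArg _ (congrArg (j ∘ · + l ∘ x) (add_zero a))
  neg_mem' {d} hd := by
    simp only [Set.mem_ofPred_eq, hT.isDerivation_iff hj hl] at hd ⊢
    refine ⟨fun x y => ?_, fun r x => ?_, fun f x a => ?_⟩
    · rw [Pi.neg_apply, hd.1 x y]
      exact neg_add _ _
    · rw [Pi.neg_apply, hd.2.1 r x]
      exact (smul_neg _ _).symm
    · have h := hd.2.2 f x (a + (-d) ∘ x)
      have h1 : a + (-d) ∘ x + d ∘ x = a := by
        ext i
        simp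
      rw [h1] at h
      rw [h, Pi.neg_apply, map_neg, add_neg_cancel_right]

/-- Automorphisms of the kernel, the quotient and the extension that agree carry the factor system
of a lifting to that of the transported lifting. -/
theorem twist (hT : T.Realized j l) {g : MultAut R S I × MultAut R S Q} {φ : MultAut R S A}
    (hφ : ∀ i, φ.1 (j i) = j (g.1.1 i)) :
    (T.twist g).Realized j (fun x => φ.1 (l (g.2.1.symm x))) where
  map_op := hT.map_op
  add x y := by simp only [FactorData.twist, ← hφ, hT.add, map_add, map_sub]
  smul r x := by simp only [FactorData.twist, ← hφ, hT.smul, map_smul, map_sub]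
  op f x := by
    have h : g.2.1.symm (MultAlg.op (R := R) f x)
        = MultAlg.op (R := R) f (fun i => g.2.1.symm (x i)) := (g.2⁻¹).2 f x
    simp only [FactorData.twist, ← hφ, hT.op, map_sub, φ.2 f, h]
    rfl
  act f s x a := by
    have h : (T.twist g).actAt f s x a =
        g.1.1 (T.actAt f s (fun i => g.2.1.symm (x i)) (fun i => g.1.1.symm (a i))) := rfl
    rw [h, ← hφ, hT.act, φ.2 f]
    congr 1
    ext i
    by_cases hi : i ∈ s.1 <;> simp [hi, hφ]

end FactorData.Realized

end Derivation

/-! ### Automorphisms of the extension and the pairs they induce -/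

section Extension

variable {R : Type*} [Ring R] {S : MultSig} {A Q : Type*}
  [AddCommGroup A] [Module R A] [MultAlg R S A] [AddCommGroup Q] [Module R Q] [MultAlg R S Q]
  {π : MultHom R S A Q}

namespace Lifting

theorem realized (l : Lifting π) : l.factorData.Realized π.ker.subtype l.toFun where
  map_op _ _ := rfl
  add _ _ := rfl
  smul _ _ := rfl
  op _ _ := rfl
  act f s x a := by
    change MultAlg.op (R := R) f _ = _
    congr 1

/-- The component of `a` in the kernel. -/
def rem (l : Lifting π) (a : A) : π.ker :=
  ⟨a - l.toFun (π.toLinearMap a), by simp [l.section_apply]⟩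

theorem rem_add (l : Lifting π) (a : A) : (l.rem a : A) + l.toFun (π.toLinearMap a) = a :=
  sub_add_cancel _ _

theorem rem_ker (l : Lifting π) (i : π.ker) : l.rem i = i :=
  Subtype.ext (by simp [rem, l.map_zero, LinearMap.mem_ker.1 i.2])

/-- The derivation `d` gives the automorphism `a ↦ a + d (π a)`. -/
def shift (l : Lifting π) {T : FactorData R S Q π.ker}
    (hT : T.Realized π.ker.subtype l.toFun) {d : Q → π.ker} (hd : T.IsDerivation d) :
    MultAutKer π :=
  ⟨⟨{ toFun := fun a => a + d (π.toLinearMap a)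
      invFun := fun a => a - d (π.toLinearMap a)
      map_add' := fun a b => by
        rw [map_add, hd.add (π.toLinearMap a) (π.toLinearMap b)]
        exact add_add_add_comm _ _ _ _
      map_smul' := fun r a => by
        rw [map_smul, hd.smul r (π.toLinearMap a)]
        exact (smul_add _ _ _).symm
      left_inv := fun a => by simp
      right_inv := fun a => by simp }, fun f a => by
      have h := ((hT.isDerivation_iff Subtype.val_injective l.map_zero).1 hd).2.2 f
        (fun i => π.toLinearMap (a i)) (fun i => l.rem (a i))
      have h1 : π.ker.subtype ∘ (fun i => l.rem (a i)) + l.toFun ∘ (fun i => π.toLinearMap (a i))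
          = a := funext fun i => l.rem_add (a i)
      have h2 : π.ker.subtype ∘ ((fun i => l.rem (a i)) + d ∘ fun i => π.toLinearMap (a i))
          + l.toFun ∘ (fun i => π.toLinearMap (a i)) =
          fun i => a i + (d (π.toLinearMap (a i)) : A) := funext fun i => by
        have := l.rem_add (a i)
        simp only [Pi.add_apply, Function.comp_apply, map_add, Submodule.subtype_apply]
        rw [add_right_comm, this]
      rw [h1, h2] at h
      refine Eq.trans ?_ h.symm
      change _ + (d (π.toLinearMap _) : A) = _
      rw [π.map_op]
      rfl⟩, fun a => by
      change a + (d (π.toLinearMap a) : A) ∈ π.ker ↔ _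
      rw [Submodule.add_mem_iff_left _ (d _).2]⟩

end Lifting

/-- The restriction of an automorphism to the kernel. -/
def MultAutKer.restrict (φ : MultAutKer π) : MultAut R S π.ker :=
  ⟨{ toFun := fun i => ⟨φ.1.1 i, (φ.2 i).2 i.2⟩
     invFun := fun i => ⟨φ.1.1.symm i, ((φ⁻¹).2 i).2 i.2⟩
     map_add' := fun _ _ => Subtype.ext (map_add φ.1.1 _ _)
     map_smul' := fun _ _ => Subtype.ext (map_smul φ.1.1 _ _)
     left_inv := fun _ => Subtype.ext (φ.1.1.symm_apply_apply _)
     right_inv := fun _ => Subtype.ext (φ.1.1.apply_symm_apply _) },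
    fun f _ => Subtype.ext (φ.1.2 f _)⟩

/-- Since `φ` preserves the kernel, it respects its cosets; this makes `π ∘ φ ∘ l'` independent of
the section `l'`. -/
theorem MultAutKer.map_congr (φ : MultAutKer π) {a b : A}
    (h : π.toLinearMap a = π.toLinearMap b) : π.toLinearMap (φ.1.1 a) = π.toLinearMap (φ.1.1 b) := by
  rw [← sub_eq_zero, ← map_sub, ← map_sub]
  exact (φ.2 (a - b)).2 (by rw [LinearMap.mem_ker, map_sub, h, sub_self])

/-- The automorphism induced on the quotient. -/
def Lifting.induced (l : Lifting π) (φ : MultAutKer π) : MultAut R S Q :=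
  ⟨{ toFun := fun x => π.toLinearMap (φ.1.1 (l.toFun x))
     invFun := fun x => π.toLinearMap ((φ⁻¹).1.1 (l.toFun x))
     map_add' := fun x y => by
       rw [← map_add, ← map_add]
       exact MultAutKer.map_congr φ (by simp [l.section_apply])
     map_smul' := fun r x => by
       rw [RingHom.id_apply, ← map_smul, ← map_smul]
       exact MultAutKer.map_congr φ (by simp [l.section_apply])
     left_inv := fun x => by
       refine (MultAutKer.map_congr φ⁻¹ (l.section_apply _)).trans ?_
       exact (congrArg _ (φ.1.1.symm_apply_apply _)).trans (l.section_apply x)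
     right_inv := fun x => by
       refine (MultAutKer.map_congr φ (l.section_apply _)).trans ?_
       exact (congrArg _ (φ.1.1.apply_symm_apply _)).trans (l.section_apply x) },
    fun f x => by
      refine (MultAutKer.map_congr φ (b := MultAlg.op (R := R) f (fun i => l.toFun (x i))) ?_).trans ?_
      · simp only [l.section_apply, π.map_op]
      · rw [φ.1.2 f, π.map_op]
        rfl⟩

theorem Lifting.induced_apply (l : Lifting π) (φ : MultAutKer π) (a : A) :
    (l.induced φ).1 (π.toLinearMap a) = π.toLinearMap (φ.1.1 a) :=
  MultAutKer.map_congr φ (l.section_apply _)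

/-- An automorphism `φ` of the extension is mapped to its restriction to the kernel and the
automorphism that it induces on the quotient. -/
def Lifting.toPair (l : Lifting π) : MultAutKer π →* MultAut R S π.ker × MultAut R S Q where
  toFun φ := (MultAutKer.restrict φ, l.induced φ)
  map_one' := by
    refine Prod.ext ?_ (Subtype.ext (LinearEquiv.ext fun x => l.section_apply x))
    rfl
  map_mul' φ χ := by
    refine Prod.ext ?_ (Subtype.ext (LinearEquiv.ext fun x => ?_))
    · rfl
    · exact (l.induced_apply φ _).symm

/-- If the twist of the factor system of a lifting is the factor system of another lifting, then
the pair of automorphisms extends. -/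
theorem Lifting.exists_extension (l l' : Lifting π) {T : FactorData R S Q π.ker}
    (hT : T.Realized π.ker.subtype l.toFun) {g : MultAut R S π.ker × MultAut R S Q}
    (hT' : (T.twist g).Realized π.ker.subtype l'.toFun) :
    ∃ φ : MultAutKer π, l.toPair φ = g := by
  -- In normal form, `i + l x ↦ σ i + l' (κ x)`. It is compatible with the operations because `σ`
  -- carries the value of `T` at `x` to that of `T^(σ,κ)` at `κ x`, which `l'` realizes.
  let F : A → A := fun a => (g.1.1 (l.rem a) : A) + l'.toFun (g.2.1 (π.toLinearMap a))
  have hF : ∀ (i : π.ker) (x : Q), F (i + l.toFun x) = (g.1.1 i : A) + l'.toFun (g.2.1 x) := by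
    intro i x
    have h1 : π.toLinearMap (i + l.toFun x) = x := by
      rw [map_add, LinearMap.mem_ker.1 i.2, l.section_apply, zero_add]
    have h2 : l.rem (i + l.toFun x) = i := Subtype.ext (by simp only [rem, h1, add_sub_cancel_right])
    simp only [F, h1, h2]
  have hπF : ∀ a, π.toLinearMap (F a) = g.2.1 (π.toLinearMap a) := by
    intro a
    simp only [F]
    rw [map_add, LinearMap.mem_ker.1 (g.1.1 _).2, l'.section_apply, zero_add]
  have hadd : ∀ a b, F (a + b) = F a + F b := by
    intro a b
    have h1 : a + b = ((l.rem a + l.rem b + T.add (π.toLinearMap a) (π.toLinearMap b) : π.ker) : A)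
        + l.toFun (π.toLinearMap a + π.toLinearMap b) := by
      have := hT.add (π.toLinearMap a) (π.toLinearMap b)
      simp only [Submodule.subtype_apply] at this
      simp only [Submodule.coe_add, this, rem]
      abel
    have h2 := hT'.add (g.2.1 (π.toLinearMap a)) (g.2.1 (π.toLinearMap b))
    simp only [FactorData.twist, LinearEquiv.symm_apply_apply, Submodule.subtype_apply] at h2
    rw [h1, hF, map_add, map_add, map_add, Submodule.coe_add, Submodule.coe_add, h2]
    simp only [F]
    abel
  have hsmul : ∀ (r : R) a, F (r • a) = r • F a := by
    intro r a
    have h1 : r • a = ((r • l.rem a + T.smul r (π.toLinearMap a) : π.ker) : A)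
        + l.toFun (r • π.toLinearMap a) := by
      have := hT.smul r (π.toLinearMap a)
      simp only [Submodule.subtype_apply] at this
      simp only [Submodule.coe_add, Submodule.coe_smul, this, rem, smul_sub]
      abel
    have h2 := hT'.smul r (g.2.1 (π.toLinearMap a))
    simp only [FactorData.twist, LinearEquiv.symm_apply_apply, Submodule.subtype_apply] at h2
    rw [h1, hF, map_add, map_smul, map_smul, Submodule.coe_add, Submodule.coe_smul, h2]
    simp only [F, smul_add]
    abel
  have hop : ∀ (f : S.Op) (a : Fin (S.arity f) → A),
      F (MultAlg.op (R := R) f a) = MultAlg.op (R := R) f (fun i => F (a i)) := by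
    intro f a
    have h1 := hT.op_add f (fun i => π.toLinearMap (a i)) (fun i => l.rem (a i))
    have h2 := hT'.op_add f (fun i => g.2.1 (π.toLinearMap (a i)))
      (fun i => g.1.1 (l.rem (a i)))
    have h3 : π.ker.subtype ∘ (fun i => l.rem (a i)) + l.toFun ∘ (fun i => π.toLinearMap (a i))
        = a := funext fun i => l.rem_add (a i)
    rw [h3] at h1
    rw [h1, Submodule.subtype_apply, hF, g.2.2 f]
    refine Eq.trans ?_ h2.symm
    simp only [map_add, map_sum, g.1.2 f, FactorData.twist, FactorData.actAt,
      Submodule.coe_add, Submodule.coe_sum, LinearEquiv.symm_apply_apply, Submodule.subtype_apply]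
  have hinj : Function.Injective F := by
    intro a b h
    have hx : π.toLinearMap a = π.toLinearMap b := g.2.1.injective (by rw [← hπF, ← hπF, h])
    simp only [F, hx, add_left_inj, Subtype.val_inj, EmbeddingLike.apply_eq_iff_eq] at h
    rw [← l.rem_add a, ← l.rem_add b, h, hx]
  have hsurj : Function.Surjective F := fun b =>
    ⟨(g.1.1.symm (l'.rem b) : A) + l.toFun (g.2.1.symm (π.toLinearMap b)), by
      rw [hF, LinearEquiv.apply_symm_apply, LinearEquiv.apply_symm_apply, l'.rem_add]⟩
  let φ : MultAutKer π :=
    ⟨⟨LinearEquiv.ofBijective { toFun := F, map_add' := hadd, map_smul' := hsmul } ⟨hinj, hsurj⟩,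
      hop⟩, fun a => by
        rw [LinearMap.mem_ker, LinearMap.mem_ker]
        exact (Eq.congr_left (hπF a)).trans (map_eq_zero_iff _ g.2.1.injective)⟩
  refine ⟨φ, Prod.ext (Subtype.ext (LinearEquiv.ext fun i => Subtype.ext ?_))
    (Subtype.ext (LinearEquiv.ext fun x => ?_))⟩
  · change F i = _
    simp only [F, l.rem_ker, LinearMap.mem_ker.1 i.2]
    rw [_root_.map_zero g.2.1, l'.map_zero, add_zero]
  · exact (hπF _).trans (by rw [l.section_apply])

variable {V : MultVariety R S}

theorem Lifting.exists_realized_of_isCobounding (l : Lifting π) {T T' : Cocycle Q π.ker V}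
    {h : Q → π.ker} (hT : T.1.Realized π.ker.subtype l.toFun) (H : T.1.IsCobounding T'.1 h) :
    ∃ l' : Lifting π, T'.1.Realized π.ker.subtype l'.toFun :=
  ⟨⟨fun x => l.toFun x - h x, fun x => by
      rw [map_sub, l.section_apply, LinearMap.mem_ker.1 (h x).2, sub_zero],
      by simp [l.map_zero, H.map_zero]⟩,
    (hT.isCobounding_iff Subtype.val_injective H.map_zero).1 H⟩

/-- Equality in `Quot` only gives a chain of cobounding steps in either direction. Stating the
invariance as an equivalence lets it pass along the chain, so transitivity of the relation itself is
not needed. -/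
theorem Cocycle.exists_realized_of_cls_eq {T T' : Cocycle Q π.ker V} (h : T.cls = T'.cls) :
    (∃ l : Lifting π, T.1.Realized π.ker.subtype l.toFun) ↔
      ∃ l : Lifting π, T'.1.Realized π.ker.subtype l.toFun := by
  have h' := Quot.eqvGen_exact h
  clear h
  induction h' with
  | rel T T' h =>
    obtain ⟨h, H⟩ := h
    exact ⟨fun ⟨l, hl⟩ => l.exists_realized_of_isCobounding hl H,
      fun ⟨l, hl⟩ => l.exists_realized_of_isCobounding hl H.symm⟩
  | refl => exact Iff.rfl
  | symm _ _ _ ih => exact ih.symm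
  | trans _ _ _ _ _ ih1 ih2 =>
    exact ih1.trans ih2

/-- The difference `l - l'` takes values in the kernel and is the cobounding map. -/
theorem Cocycle.cls_eq_of_realized {T T' : Cocycle Q π.ker V} {l l' : Q → A}
    (hl : T.1.Realized π.ker.subtype l) (hl' : T'.1.Realized π.ker.subtype l')
    (h : ∀ x, π.toLinearMap (l x) = π.toLinearMap (l' x)) (h0 : l 0 = l' 0) :
    T.cls = T'.cls := by
  refine Quot.sound ⟨fun x => ⟨l x - l' x, by rw [LinearMap.mem_ker, map_sub, h, sub_self]⟩, ?_⟩
  rw [hl.isCobounding_iff Subtype.val_injective (by simp [h0])]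
  simpa using hl'

/-- The Wells map vanishes precisely on the pairs that extend to the extension. -/
theorem Lifting.range_toPair (l : Lifting π) {T : Cocycle Q π.ker V}
    (hT : T.1.Realized π.ker.subtype l.toFun) :
    Set.range (l.toPair) = {g | T.wells g = 0} := by
  ext g
  simp only [Set.mem_range, Set.mem_ofPred_eq, Cocycle.wells, sub_eq_zero,
    FreeAbelianGroup.of_injective.eq_iff]
  constructor
  · rintro ⟨φ, rfl⟩
    -- The twisted cocycle comes from `φ ∘ l ∘ κ⁻¹`, again a section of `π` because `φ` induces `κ`.
    have h := hT.twist (g := l.toPair φ) (φ := φ.1) fun _ => rfl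
    refine Cocycle.cls_eq_of_realized (T' := T.twist _) hT h (fun x => ?_) (by simp [l.map_zero])
    rw [l.section_apply]
    exact ((l.toPair φ).2.1.apply_symm_apply x).symm
  · intro h
    obtain ⟨l', hl'⟩ := (Cocycle.exists_realized_of_cls_eq h).1 ⟨l, hT⟩
    exact l.exists_extension l' hT hl'

end Extension

/-! ### The derivations as the kernel of `ψ` -/

section Sequence

variable {R : Type*} [Ring R] {S : MultSig} {A Q : Type*}
  [AddCommGroup A] [Module R A] [MultAlg R S A] [AddCommGroup Q] [Module R Q] [MultAlg R S Q]
  {π : MultHom R S A Q}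

namespace Lifting

/-- The group of derivations for the factor system of a lifting. -/
abbrev der (l : Lifting π) : AddSubgroup (Q → π.ker) :=
  l.realized.derivations Subtype.val_injective l.map_zero

/-- The embedding of the derivations in the automorphisms that preserve the kernel. -/
def ofDer (l : Lifting π) : Multiplicative l.der →* MultAutKer π where
  toFun d := l.shift l.realized (d := d.toAdd.1) d.toAdd.2
  map_one' := Subtype.ext (Subtype.ext (LinearEquiv.ext fun a => add_zero a))
  map_mul' d e := by
    refine Subtype.ext (Subtype.ext (LinearEquiv.ext fun a => ?_))
    change a + ((d.toAdd.1 (π.toLinearMap a) : A) + e.toAdd.1 (π.toLinearMap a)) =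
      a + (e.toAdd.1 (π.toLinearMap a) : A) +
        d.toAdd.1 (π.toLinearMap (a + e.toAdd.1 (π.toLinearMap a)))
    -- `π` kills the values of `e`, so after the first shift `d` is still evaluated at `π a`;
    -- composition thus becomes addition.
    rw [map_add, LinearMap.mem_ker.1 (e.toAdd.1 (π.toLinearMap a)).2, add_zero]
    abel

theorem ofDer_apply (l : Lifting π) (d : l.der) (a : A) :
    (l.ofDer (Multiplicative.ofAdd d)).1.1 a = a + (d.1 (π.toLinearMap a) : A) := rfl

theorem ofDer_injective (l : Lifting π) : Function.Injective l.ofDer := by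
  intro d e h
  refine Multiplicative.toAdd.injective (Subtype.ext (funext fun x => Subtype.ext ?_))
  have h1 := congrArg (fun φ : MultAutKer π => φ.1.1 (l.toFun x)) h
  have h2 : l.toFun x + (d.toAdd.1 (π.toLinearMap (l.toFun x)) : A) =
    l.toFun x + (e.toAdd.1 (π.toLinearMap (l.toFun x)) : A) := h1
  rwa [add_right_inj, l.section_apply] at h2

theorem range_ofDer (l : Lifting π) : l.ofDer.range = l.toPair.ker := by
  ext φ
  rw [MonoidHom.mem_ker]
  constructor
  · rintro ⟨d, rfl⟩
    refine Prod.ext (Subtype.ext (LinearEquiv.ext fun i => Subtype.ext ?_))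
      (Subtype.ext (LinearEquiv.ext fun x => ?_))
    · change (i : A) + (d.toAdd.1 (π.toLinearMap i) : A) = i
      have h0 : d.toAdd.1 0 = 0 := by
        have h : d.toAdd.1 (0 + 0) = d.toAdd.1 0 + d.toAdd.1 0 :=
          FactorData.IsDerivation.add d.toAdd.2 0 0
        rwa [add_zero, left_eq_add] at h
      rw [LinearMap.mem_ker.1 i.2, h0, Submodule.coe_zero, add_zero]
    · change π.toLinearMap (l.toFun x + (d.toAdd.1 (π.toLinearMap (l.toFun x)) : A)) = x
      rw [map_add, LinearMap.mem_ker.1 (d.toAdd.1 _).2, add_zero, l.section_apply]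
  · intro h
    have hker : ∀ i : π.ker, φ.1.1 i = i := fun i =>
      congrArg (fun g : MultAut R S π.ker × MultAut R S Q => ((g.1.1 i : π.ker) : A)) h
    have hquot : ∀ x, π.toLinearMap (φ.1.1 (l.toFun x)) = x := fun x =>
      congrArg (fun g : MultAut R S π.ker × MultAut R S Q => g.2.1 x) h
    -- The displacement of the lifting lies in the kernel because `φ` induces the identity on `Q`.
    -- As `φ` also fixes the kernel, it displaces every `a` by `d (π a)`.
    let d : Q → π.ker := fun x => ⟨φ.1.1 (l.toFun x) - l.toFun x, by
      rw [LinearMap.mem_ker, map_sub, hquot, l.section_apply, sub_self]⟩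
    have hdl : ∀ x, φ.1.1 (l.toFun x) = d x + l.toFun x := fun x => (sub_add_cancel _ _).symm
    have hd : ∀ a, φ.1.1 a = a + (d (π.toLinearMap a) : A) := fun a => by
      conv_lhs => rw [← l.rem_add a]
      rw [map_add, hker, hdl, add_left_comm, l.rem_add, add_comm]
    have hdπ : ∀ a, (d (π.toLinearMap a) : A) = φ.1.1 a - a := fun a => by
      rw [hd, add_sub_cancel_left]
    have hder : l.factorData.IsDerivation d := by
      refine (l.realized.isDerivation_iff Subtype.val_injective l.map_zero).2
        ⟨fun x y => Subtype.ext ?_, fun r x => Subtype.ext ?_, fun f x a => ?_⟩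
      · rw [Submodule.coe_add, ← l.section_apply x, ← l.section_apply y, ← map_add, hdπ, hdπ, hdπ,
          map_add]
        abel
      · rw [Submodule.coe_smul, ← l.section_apply x, ← map_smul, hdπ, hdπ, map_smul, smul_sub]
      · have h1 := hd (MultAlg.op (R := R) f (π.ker.subtype ∘ a + l.toFun ∘ x))
        have h2 : ∀ i, π.toLinearMap ((π.ker.subtype ∘ a + l.toFun ∘ x) i) = x i := fun i => by
          simp [l.section_apply]
        rw [φ.1.2 f, π.map_op] at h1
        simp only [h2] at h1
        refine Eq.trans (congrArg _ (funext fun i => ?_)) h1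
        simp only [Pi.add_apply, Function.comp_apply, map_add, Submodule.subtype_apply, hker, hdl]
        exact add_assoc _ _ _
    exact ⟨Multiplicative.ofAdd ⟨d, hder⟩,
      Subtype.ext (Subtype.ext (LinearEquiv.ext fun a => (hd a).symm))⟩

end Lifting

end Sequence

/-- Exactness of `1 → Der(Q,I) → Aut_I A → Aut I × Aut Q → FA(H²_V(Q,I))` for an extension
`π : A → Q` in `V` with kernel `I` and the 2-cocycle `T` associated to it by a lifting `l`. -/
theorem theorem4 {R : Type*} [Ring R] {S : MultSig} (V : MultVariety R S) {A Q : Type*}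
    [AddCommGroup A] [Module R A] [MultAlg R S A] [AddCommGroup Q] [Module R Q] [MultAlg R S Q]
    (hA : V.Mem (MultAlg.toRaw R S A)) (π : MultHom R S A Q)
    (hπ : Function.Surjective π.toLinearMap) (l : Lifting π)
    (T : Cocycle Q π.ker V) (hT : T = l.cocycle hA) :
    ∃ (Der : AddSubgroup (Q → π.ker)) (ι : Multiplicative Der →* MultAutKer π)
      (ψ : MultAutKer π →* MultAut R S π.ker × MultAut R S Q),
      -- `Der` consists of the derivations, and `ι d` is the automorphism `a ↦ a + d (π a)`
      (∀ d : Q → π.ker, d ∈ Der ↔ T.1.IsDerivation d) ∧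
      (∀ (d : Der) (a : A), (ι (Multiplicative.ofAdd d)).1.1 a = a + (d.1 (π.toLinearMap a) : A)) ∧
      -- `ψ φ` is the pair of the restriction of `φ` to the kernel and of `π ∘ φ ∘ l'`
      (∀ (φ : MultAutKer π) (i : π.ker), (((ψ φ).1.1 i : π.ker) : A) = φ.1.1 (i : A)) ∧
      (∀ (φ : MultAutKer π) (l' : Q → A), (∀ x, π.toLinearMap (l' x) = x) →
        ∀ x : Q, (ψ φ).2.1 x = π.toLinearMap (φ.1.1 (l' x))) ∧
      -- exactness
      Function.Injective ι ∧
      ι.range = ψ.ker ∧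
      Set.range ψ = {g | T.wells g = 0} := by
  subst hT
  refine ⟨l.der, l.ofDer, l.toPair, fun d => Iff.rfl, l.ofDer_apply, fun φ i => rfl,
    fun φ l' hl' x => ?_, l.ofDer_injective, l.range_ofDer, l.range_toPair l.realized⟩
  rw [← l.induced_apply φ (l' x), hl']
  rfl
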